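/- Let $G$ be a finite simple undirected graph with vertex set $V$ and edge set $E$. A graph is called $2$-edge-connected if it is connected and has no bridge; the empty graph and the one-vertex graph count as $2$-edge-connected. For $\emptyset\subsetneq S\subsetneq V$ let $\delta(S)$ be the set of edges with exactly one endpoint in $S$; the sets $\delta(S)$ are the cuts of $G$, and a cut is minimal if no proper subset of it is a cut. Two distinct edges are coparallel if they form a minimal cut of size $2$; a coparallel class of a $2$-edge-connected graph is an inclusion-wise maximal set of edges in which every two distinct edges are coparallel. Let $$\mathrm{TECSP}(G)=\operatorname{conv}\{\chi^{E(H)} : H\subseteq G \text{ is a } 2\text{-edge-connected subgraph}\}\subseteq\mathbb{R}^{E},$$ where $\chi^{F}\in\{0,1\}^E$ is the incidence vector of $F\subseteq E$, and write $x(F)=\sum_{f\in F}x_f$. An inequality $a^{T}x\le b$ defines a facet of a polytope $P$ if it holds for all $x\in P$ and $\dim\{x\in P : a^{T}x=b\}=\dim P-1$. **Theorem.** Let $G$ be $2$-edge-connected and let $\emptyset\subsetneq S\subsetneq V$ be such that $\delta(S)$ is a minimal cut with $|\delta(S)|\ge 3$. Let $e\in\delta(S)$. Then the asymmetric cut inequality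 $$x_e-x(\delta(S)\setminus\{e\})\le 0$$ defines a facet of $\mathrm{TECSP}(G)$ if and only if every bridge of $G[S]$ and every bridge of $G[V\setminus S]$ lies in a coparallel class of $G$ together with an edge of $\delta(S)$. -/

import Mathlib

namespace TwoEdgeConn

variable {V : Type*}

/-- Mathlib's `2`-edge-connectedness says that the graph is connected (or empty) and has no
bridge. -/
theorem isEdgeConnected_two_iff (G : SimpleGraph V) :
    G.IsEdgeConnected 2 ↔ G.Preconnected ∧ ∀ e ∈ G.edgeSet, ¬ G.IsBridge e := by
  constructor
  · intro h
    refine ⟨h.preconnected (by norm_num), ?_⟩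
    rintro ⟨u, v⟩ - hb
    exact hb.not_isEdgeReachable_two (h u v)
  · rintro ⟨h, hb⟩ u v
    obtain ⟨p⟩ := h u v
    induction p with
    | nil => exact .rfl
    | cons hadj _ ih =>
      have h2 := not_not.mp
        (mt (SimpleGraph.isBridge_iff_not_isEdgeReachable_two hadj).mpr (hb _ hadj))
      exact fun s hs => (h2 hs).trans (ih hs)

/-- The cut `δ(S)`: all edges of `G` with exactly one endpoint in `S`. -/
def cut (G : SimpleGraph V) (S : Set V) : Set (Sym2 V) :=
  {e ∈ G.edgeSet | ∃ u ∈ S, ∃ v ∉ S, e = s(u, v)}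

/-- `F` is a cut, i.e. `F = δ(S)` for some `∅ ⊊ S ⊊ V`. -/
def IsCut (G : SimpleGraph V) (F : Set (Sym2 V)) : Prop :=
  ∃ S : Set V, S.Nonempty ∧ S ≠ Set.univ ∧ F = cut G S

/-- `F` is an inclusion-minimal (nonempty) cut. If `G` is connected, every cut is nonempty, and
the nonemptiness requirement is vacuous. -/
def IsMinimalCut (G : SimpleGraph V) (F : Set (Sym2 V)) : Prop :=
  Minimal (fun F' => IsCut G F' ∧ F'.Nonempty) F

/-- Two distinct edges are coparallel if they form a minimal cut of size two. -/
def Coparallel (G : SimpleGraph V) (e f : Sym2 V) : Prop :=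
  e ≠ f ∧ IsMinimalCut G {e, f}

/-- A coparallel class: an inclusion-wise maximal set of edges (bridges are left out)
whose distinct elements are pairwise coparallel. -/
def IsCoparallelClass (G : SimpleGraph V) (C : Set (Sym2 V)) : Prop :=
  C.Nonempty ∧
    Maximal (fun C' : Set (Sym2 V) =>
      C' ⊆ G.edgeSet ∧ (∀ e ∈ C', ¬ G.IsBridge e) ∧ C'.Pairwise (Coparallel G)) C

/-- The incidence vector in `ℝ^{E(G)}` of a set of edges. -/
noncomputable def incidenceVector (G : SimpleGraph V) (F : Set (Sym2 V)) : G.edgeSet → ℝ :=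
  fun e => F.indicator 1 (e : Sym2 V)

/-- The `2`-edge-connected subgraph polytope: the convex hull of the incidence vectors of the
`2`-edge-connected subgraphs. Subgraphs with at most one vertex count as `2`-edge-connected. -/
def TECSP (G : SimpleGraph V) : Set (G.edgeSet → ℝ) :=
  convexHull ℝ {x | ∃ H : G.Subgraph, H.coe.IsEdgeConnected 2 ∧ x = incidenceVector G H.edgeSet}

open Classical in
/-- The linear form `x ↦ x(F) = ∑_{f ∈ F} x_f` on `ℝ^{E(G)}`. -/
noncomputable def edgeSum (G : SimpleGraph V) [Fintype G.edgeSet] (F : Set (Sym2 V)) :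
    (G.edgeSet → ℝ) →ₗ[ℝ] ℝ :=
  ∑ f ∈ Finset.univ.filter (fun f : G.edgeSet => (f : Sym2 V) ∈ F), LinearMap.proj f

/-- The dimension of the affine hull of `P` (for nonempty `P`). -/
noncomputable def affDim {E : Type*} [AddCommGroup E] [Module ℝ E] (P : Set E) : ℕ :=
  Module.finrank ℝ (vectorSpan ℝ P)

/-- The face of `P` cut out by the inequality `a x ≤ b`. -/
def face {E : Type*} [AddCommGroup E] [Module ℝ E] (P : Set E) (a : E →ₗ[ℝ] ℝ) (b : ℝ) : Set E :=
  {x ∈ P | a x = b}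

/-- The inequality `a x ≤ b` defines a facet of `P`: it is valid on `P`, and the face
`P ∩ {a x = b}` is nonempty of dimension `dim P - 1`. -/
def DefinesFacet {E : Type*} [AddCommGroup E] [Module ℝ E]
    (P : Set E) (a : E →ₗ[ℝ] ℝ) (b : ℝ) : Prop :=
  (∀ x ∈ P, a x ≤ b) ∧ (face P a b).Nonempty ∧ affDim (face P a b) + 1 = affDim P

/-- Every bridge of the induced subgraph `G[T]` lies in a coparallel class of `G` together with
an edge of `F`. -/
def BridgesCoparallelTo (G : SimpleGraph V) (T : Set V) (F : Set (Sym2 V)) : Prop :=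
  ∀ u v : T, (G.induce T).Adj u v → (G.induce T).IsBridge s(u, v) →
    ∃ C, IsCoparallelClass G C ∧ s((u : V), (v : V)) ∈ C ∧ ∃ g ∈ F, g ∈ C

end TwoEdgeConn

namespace TwoEdgeConn

open scoped symmDiff

section Cuts

variable {V : Type*} {K G : SimpleGraph V} {A B : Set V}

theorem mk_mem_cut {u v : V} : s(u, v) ∈ cut K A ↔ K.Adj u v ∧ (u ∈ A ↔ v ∉ A) := by
  simp only [cut, Set.mem_ofPred_eq, SimpleGraph.mem_edgeSet]
  refine and_congr_right fun _ => ⟨?_, fun h => ?_⟩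
  · rintro ⟨x, hx, y, hy, h⟩
    rcases Sym2.eq_iff.mp h with ⟨rfl, rfl⟩ | ⟨rfl, rfl⟩ <;> tauto
  · by_cases hu : u ∈ A
    · exact ⟨u, hu, v, h.mp hu, rfl⟩
    · exact ⟨v, by tauto, u, hu, Sym2.eq_swap⟩

theorem cut_subset_edgeSet (K : SimpleGraph V) (A : Set V) : cut K A ⊆ K.edgeSet :=
  fun _ h => h.1

theorem cut_symmDiff (K : SimpleGraph V) (A B : Set V) : cut K (A ∆ B) = cut K A ∆ cut K B := by
  ext d
  induction d with | h u v =>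
  simp only [Set.mem_symmDiff, mk_mem_cut]
  tauto

@[simp] theorem cut_compl (K : SimpleGraph V) (A : Set V) : cut K Aᶜ = cut K A := by
  ext d
  induction d with | h u v =>
  simp only [Set.mem_compl_iff, mk_mem_cut]
  tauto

@[simp] theorem cut_empty (K : SimpleGraph V) : cut K ∅ = ∅ := by
  ext d
  simp [cut]

theorem cut_deleteEdges (K : SimpleGraph V) (D : Set (Sym2 V)) (A : Set V) :
    cut (K.deleteEdges D) A = cut K A \ D := by
  ext d
  induction d with | h u v =>
  simp only [Set.mem_sdiff, mk_mem_cut, SimpleGraph.deleteEdges_adj]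
  tauto

theorem cut_of_le (h : K ≤ G) (A : Set V) : cut K A = cut G A ∩ K.edgeSet := by
  ext d
  induction d with | h u v =>
  simp only [Set.mem_inter_iff, mk_mem_cut, SimpleGraph.mem_edgeSet]
  have := @h u v
  tauto

theorem cut_inter_subset (K : SimpleGraph V) (A B : Set V) :
    cut K (A ∩ B) ⊆ cut K A ∪ cut K B := by
  intro d
  induction d with | h u v =>
  simp only [Set.mem_union, Set.mem_inter_iff, mk_mem_cut]
  tauto

theorem cut_union_subset (K : SimpleGraph V) (A B : Set V) :
    cut K (A ∪ B) ⊆ cut K A ∪ cut K B := by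
  intro d
  induction d with | h u v =>
  simp only [Set.mem_union, mk_mem_cut]
  tauto

/-- An edge crossing exactly one of `A`, `B` does not cross both `A ∩ B` and `A ∪ B`. -/
theorem notMem_cut_union_of_mem_cut_inter {d : Sym2 V} (hB : d ∉ cut K A ∨ d ∉ cut K B)
    (h : d ∈ cut K (A ∩ B)) : d ∉ cut K (A ∪ B) := by
  induction d with | h u v =>
  simp only [Set.mem_union, Set.mem_inter_iff, mk_mem_cut] at *
  tauto

theorem mem_of_reachable_of_cut_eq_empty (hA : cut K A = ∅) {u v : V} (h : K.Reachable u v)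
    (hu : u ∈ A) : v ∈ A := by
  obtain ⟨p⟩ := h
  induction p with
  | nil => exact hu
  | @cons x y z hadj _ ih =>
    refine ih ?_
    by_contra hy
    have : s(x, y) ∈ cut K A := mk_mem_cut.mpr ⟨hadj, by tauto⟩
    simp [hA] at this

theorem cut_setOf_reachable (K : SimpleGraph V) (u : V) : cut K {w | K.Reachable u w} = ∅ := by
  ext d
  induction d with | h x y =>
  simp only [mk_mem_cut, Set.mem_ofPred_eq, Set.mem_empty_iff_false, iff_false, not_and]
  intro h
  have h1 : K.Reachable u x → K.Reachable u y := fun hx => hx.trans h.reachable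
  have h2 : K.Reachable u y → K.Reachable u x := fun hx => hx.trans h.symm.reachable
  tauto

theorem isBridge_iff_exists_cut {d : Sym2 V} (hd : d ∈ K.edgeSet) :
    K.IsBridge d ↔ ∃ A, cut K A = {d} := by
  induction d with | h u v =>
  rw [SimpleGraph.isBridge_iff]
  constructor
  · intro h
    refine ⟨{w | (K.deleteEdges {s(u, v)}).Reachable u w}, ?_⟩
    have h1 := cut_setOf_reachable (K.deleteEdges {s(u, v)}) u
    rw [cut_deleteEdges, Set.sdiff_eq_empty] at h1
    refine h1.antisymm ?_
    rw [Set.singleton_subset_iff, mk_mem_cut]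
    refine ⟨hd, ?_⟩
    simp only [Set.mem_ofPred_eq, h, not_false_eq_true, iff_true]
    exact SimpleGraph.Reachable.refl _
  · rintro ⟨A, hA⟩ h
    have h1 : cut (K.deleteEdges {s(u, v)}) A = ∅ := by
      rw [cut_deleteEdges, hA, Set.sdiff_self]
    have h2 : s(u, v) ∈ cut K A := by simp [hA]
    rw [mk_mem_cut] at h2
    have h3 := mem_of_reachable_of_cut_eq_empty h1 h
    have h4 := mem_of_reachable_of_cut_eq_empty h1 h.symm
    tauto

theorem cut_nonempty (hK : K.Preconnected) (hA : A.Nonempty) (hA' : A ≠ Set.univ) :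
    (cut K A).Nonempty := by
  rw [Set.nonempty_iff_ne_empty]
  intro h
  obtain ⟨u, hu⟩ := hA
  exact hA' (Set.eq_univ_of_forall fun v => mem_of_reachable_of_cut_eq_empty h (hK u v) hu)

theorem cut_ne_singleton (hG : G.IsEdgeConnected 2) (A : Set V) (d : Sym2 V) : cut G A ≠ {d} := by
  intro h
  have hd : d ∈ G.edgeSet := cut_subset_edgeSet G A (by simp [h])
  exact ((isEdgeConnected_two_iff G).mp hG).2 d hd ((isBridge_iff_exists_cut hd).mpr ⟨A, h⟩)

theorem isCut_cut (h : (cut G A).Nonempty) : IsCut G (cut G A) := by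
  refine ⟨A, ?_, ?_, rfl⟩
  · rw [Set.nonempty_iff_ne_empty]
    rintro rfl
    simp at h
  · rintro rfl
    rw [← Set.compl_empty, cut_compl, cut_empty] at h
    exact Set.not_nonempty_empty h

theorem coparallel_iff (hG : G.IsEdgeConnected 2) {c d : Sym2 V} :
    Coparallel G c d ↔ c ≠ d ∧ ∃ A, cut G A = {c, d} := by
  refine and_congr_right fun hcd => ⟨?_, ?_⟩
  · rintro ⟨⟨⟨A, -, -, h⟩, -⟩, -⟩
    exact ⟨A, h.symm⟩
  · rintro ⟨A, hA⟩
    have hne : (cut G A).Nonempty := by simp [hA]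
    refine ⟨⟨hA ▸ isCut_cut hne, by simp⟩, ?_⟩
    rintro F ⟨⟨B, -, -, rfl⟩, hF⟩ hsub
    rcases Set.subset_pair_iff_eq.mp hsub with h | h | h | h
    · simp [h] at hF
    · exact absurd h (cut_ne_singleton hG _ _)
    · exact absurd h (cut_ne_singleton hG _ _)
    · exact h.ge

/-- The edges crossing `A` in a `2`-edge-connected subgraph never consist of a single edge. -/
theorem cut_inter_edgeSet_ne_singleton {H : G.Subgraph} (hH : H.coe.IsEdgeConnected 2)
    (A : Set V) (d : Sym2 V) : cut G A ∩ H.edgeSet ≠ {d} := by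
  intro h
  induction d with | h u v =>
  have hd : s(u, v) ∈ cut G A ∩ H.edgeSet := by simp [h]
  have huv : H.Adj u v := hd.2
  refine cut_ne_singleton hH (Subtype.val ⁻¹' A) s(⟨u, huv.fst_mem⟩, ⟨v, huv.snd_mem⟩) ?_
  ext c
  induction c with | h x y =>
  obtain ⟨x, hx⟩ := x
  obtain ⟨y, hy⟩ := y
  have := Set.ext_iff.mp h s(x, y)
  simp only [Set.mem_inter_iff, mk_mem_cut, SimpleGraph.Subgraph.mem_edgeSet,
    Set.mem_singleton_iff, Sym2.eq_iff] at this
  simp only [mk_mem_cut, SimpleGraph.Subgraph.coe_adj, Set.mem_preimage,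
    Set.mem_singleton_iff, Sym2.eq_iff, Subtype.mk.injEq, ← this]
  have := @H.adj_sub x y
  tauto

/-- The edges of `K` that are not bridges. -/
def core (K : SimpleGraph V) : Set (Sym2 V) :=
  {d ∈ K.edgeSet | ∀ A, cut K A ≠ {d}}

/-- The edge `c` together with the edges forming a cut of size two with `c`. -/
def coparClass (K : SimpleGraph V) (c : Sym2 V) : Set (Sym2 V) :=
  {d | d = c ∨ ∃ A, cut K A = {c, d}}

theorem core_subset_edgeSet (K : SimpleGraph V) : core K ⊆ K.edgeSet := fun _ h => h.1

theorem self_mem_coparClass (K : SimpleGraph V) (c : Sym2 V) : c ∈ coparClass K c := Or.inl rfl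

theorem mem_core_iff {d : Sym2 V} : d ∈ core K ↔ d ∈ K.edgeSet ∧ ¬ K.IsBridge d := by
  refine and_congr_right fun hd => ?_
  rw [isBridge_iff_exists_cut hd, not_exists]

theorem core_mono (h : K ≤ G) : core K ⊆ core G := fun d hd =>
  ⟨SimpleGraph.edgeSet_subset_edgeSet.mpr h hd.1, fun A hA => hd.2 A <| by
    rw [cut_of_le h, hA, Set.inter_eq_left, Set.singleton_subset_iff]
    exact hd.1⟩

theorem core_eq_edgeSet (hG : G.IsEdgeConnected 2) : core G = G.edgeSet :=
  Set.Subset.antisymm (core_subset_edgeSet G) fun d hd => ⟨hd, fun A => cut_ne_singleton hG A d⟩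

theorem coparClass_subset_core {c : Sym2 V} (hc : c ∈ core K) : coparClass K c ⊆ core K := by
  rintro d (rfl | ⟨A, hA⟩)
  · exact hc
  · refine ⟨cut_subset_edgeSet K A (by simp [hA]), fun B hB => ?_⟩
    by_cases hcd : c = d
    · exact hc.2 B (hcd ▸ hB)
    · refine hc.2 (A ∆ B) ?_
      rw [cut_symmDiff, hA, hB]
      ext x
      simp only [Set.mem_symmDiff, Set.mem_insert_iff, Set.mem_singleton_iff]
      grind

theorem coparClass_symm {c d : Sym2 V} (h : d ∈ coparClass K c) : c ∈ coparClass K d := by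
  rcases h with rfl | ⟨A, hA⟩
  · exact Or.inl rfl
  · exact Or.inr ⟨A, hA.trans (Set.pair_comm _ _)⟩

theorem coparClass_trans {b c d : Sym2 V} (h : c ∈ coparClass K b) (h' : d ∈ coparClass K c) :
    d ∈ coparClass K b := by
  by_cases hbd : d = b
  · exact Or.inl hbd
  rcases h with rfl | ⟨A, hA⟩
  · exact h'
  rcases h' with rfl | ⟨B, hB⟩
  · exact Or.inr ⟨A, hA⟩
  by_cases hbc : b = c
  · exact Or.inr ⟨B, hbc ▸ hB⟩
  by_cases hcd : d = c
  · exact Or.inr ⟨A, hcd ▸ hA⟩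
  refine Or.inr ⟨A ∆ B, ?_⟩
  rw [cut_symmDiff, hA, hB]
  ext x
  simp only [Set.mem_symmDiff, Set.mem_insert_iff, Set.mem_singleton_iff]
  grind

theorem core_deleteEdges_singleton (K : SimpleGraph V) (c : Sym2 V) :
    core (K.deleteEdges {c}) = core K \ coparClass K c := by
  ext d
  constructor
  · intro hd
    refine ⟨core_mono (SimpleGraph.deleteEdges_le _) hd, ?_⟩
    have hdc : d ≠ c := by
      have := hd.1
      rw [SimpleGraph.edgeSet_deleteEdges] at this
      exact this.2
    rintro (h | ⟨A, hA⟩)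
    · exact hdc h
    · refine hd.2 A ?_
      rw [cut_deleteEdges, hA]
      ext x
      simp only [Set.mem_sdiff, Set.mem_insert_iff, Set.mem_singleton_iff]
      grind
  · rintro ⟨hd, hdc⟩
    refine ⟨?_, fun A hA => ?_⟩
    · rw [SimpleGraph.edgeSet_deleteEdges]
      exact ⟨hd.1, fun h => hdc (Or.inl h)⟩
    · rw [cut_deleteEdges] at hA
      by_cases hcA : c ∈ cut K A
      · refine hdc (Or.inr ⟨A, ?_⟩)
        rw [← Set.insert_sdiff_self_of_mem hcA, hA]
      · rw [Set.sdiff_singleton_eq_self hcA] at hA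
        exact hd.2 A hA

/-- Two edges lie in a common coparallel class iff they agree or form a cut of size two. -/
theorem exists_isCoparallelClass_iff (hG : G.IsEdgeConnected 2) {b g : Sym2 V}
    (hb : b ∈ G.edgeSet) :
    (∃ C, IsCoparallelClass G C ∧ b ∈ C ∧ g ∈ C) ↔ g ∈ coparClass G b := by
  constructor
  · rintro ⟨C, ⟨-, hC, -⟩, hbC, hgC⟩
    by_cases hbg : b = g
    · exact Or.inl hbg.symm
    · exact Or.inr ((coparallel_iff hG).mp (hC.2.2 hbC hgC hbg)).2
  · intro hg
    have hbcore : b ∈ core G := by rwa [core_eq_edgeSet hG]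
    refine ⟨coparClass G b, ⟨⟨b, self_mem_coparClass G b⟩, ⟨?_, ?_, ?_⟩, ?_⟩,
      self_mem_coparClass G b, hg⟩
    · exact (coparClass_subset_core hbcore).trans (core_subset_edgeSet G)
    · exact fun d hd => (mem_core_iff.mp (coparClass_subset_core hbcore hd)).2
    · intro c hc d hd hcd
      refine (coparallel_iff hG).mpr ⟨hcd, ?_⟩
      rcases coparClass_trans (coparClass_symm hc) hd with h | h
      · exact absurd h.symm hcd
      · exact h
    · rintro C' ⟨-, -, hC'⟩ hle d hd
      by_cases hbd : b = d
      · exact Or.inl hbd.symm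
      · exact Or.inr ((coparallel_iff hG).mp (hC' (hle (self_mem_coparClass G b)) hd hbd)).2

end Cuts

section Components

variable {V : Type*} {K G : SimpleGraph V}

theorem cut_image_val {T : Set V} (hT : cut K T = ∅) (A : Set T) :
    cut K (Subtype.val '' A) = Sym2.map Subtype.val '' cut (K.induce T) A := by
  have hmem : ∀ x y, K.Adj x y → (x ∈ T ↔ y ∈ T) := by
    intro x y hxy
    have : s(x, y) ∉ cut K T := by simp [hT]
    rw [mk_mem_cut] at this
    tauto
  ext d
  constructor
  · induction d with | h x y =>
    rw [mk_mem_cut]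
    rintro ⟨hxy, h⟩
    have hxT : x ∈ T := by
      by_contra hx
      have hy : y ∉ T := fun hy => hx ((hmem x y hxy).mpr hy)
      have h1 : x ∉ Subtype.val '' A := by rintro ⟨a, -, rfl⟩; exact hx a.2
      have h2 : y ∉ Subtype.val '' A := by rintro ⟨a, -, rfl⟩; exact hy a.2
      tauto
    have hyT : y ∈ T := (hmem x y hxy).mp hxT
    refine ⟨s(⟨x, hxT⟩, ⟨y, hyT⟩), ?_, rfl⟩
    rw [mk_mem_cut]
    refine ⟨hxy, ?_⟩
    simpa [hxT, hyT] using h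
  · rintro ⟨c, hc, rfl⟩
    induction c with | h x y =>
    rw [mk_mem_cut] at hc
    rw [Sym2.map_mk, mk_mem_cut]
    refine ⟨hc.1, ?_⟩
    simpa using hc.2

theorem induce_preconnected {T : Set V} (hT : cut K T = ∅)
    (hconn : ∀ A ⊆ T, cut K A = ∅ → A = ∅ ∨ A = T) : (K.induce T).Preconnected := by
  intro u v
  rcases hconn (Subtype.val '' {w | (K.induce T).Reachable u w}) (by simp)
    (by rw [cut_image_val hT, cut_setOf_reachable, Set.image_empty]) with h | h
  · rw [Set.image_eq_empty] at h
    exact absurd (SimpleGraph.Reachable.refl u) (Set.eq_empty_iff_forall_notMem.mp h u)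
  · obtain ⟨w, hw, hwv⟩ := h.ge v.2
    rwa [← Subtype.ext hwv]

theorem exists_cut_of_induce_isBridge {T : Set V} (hT : cut K T = ∅) {u v : T}
    (hadj : (K.induce T).Adj u v) (h : (K.induce T).IsBridge s(u, v)) :
    ∃ A ⊆ T, cut K A = {s((u : V), (v : V))} := by
  obtain ⟨A, hA⟩ := (isBridge_iff_exists_cut hadj).mp h
  refine ⟨Subtype.val '' A, by simp, ?_⟩
  rw [cut_image_val hT, hA, Set.image_singleton, Sym2.map_mk]

theorem induce_isBridge_of_cut {T A : Set V} {u v : T} (h : cut K A = {s((u : V), (v : V))}) :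
    (K.induce T).IsBridge s(u, v) := by
  have hd : s((u : V), (v : V)) ∈ K.edgeSet := cut_subset_edgeSet K A (by simp [h])
  refine (isBridge_iff_exists_cut (K := K.induce T) hd).mpr ⟨Subtype.val ⁻¹' A, ?_⟩
  ext c
  induction c with | h x y =>
  have := Set.ext_iff.mp h s((x : V), (y : V))
  rw [mk_mem_cut] at this ⊢
  simp only [Set.mem_singleton_iff, Sym2.eq_iff, ← Subtype.ext_iff] at this ⊢
  exact this

theorem induce_deleteEdges_cut (G : SimpleGraph V) (T : Set V) :
    (G.deleteEdges (cut G T)).induce T = G.induce T := by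
  ext x y
  have : s((x : V), (y : V)) ∉ cut G T := by simp [mk_mem_cut, x.2, y.2]
  simp [SimpleGraph.deleteEdges_adj, this]

/-- Restricting a subgraph `K` of `G` to a vertex set. -/
def restrictSubgraph (h : K ≤ G) (T : Set V) : G.Subgraph where
  verts := T
  Adj u v := K.Adj u v ∧ u ∈ T ∧ v ∈ T
  adj_sub huv := h huv.1
  edge_vert huv := huv.2.1
  symm := ⟨fun _ _ huv => ⟨huv.1.symm, huv.2.2, huv.2.1⟩⟩

theorem restrictSubgraph_coe (h : K ≤ G) (T : Set V) :
    (restrictSubgraph h T).coe = K.induce T := by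
  ext u v
  exact ⟨fun huv => huv.1, fun huv => ⟨huv, u.2, v.2⟩⟩

/-- The spanning subgraph of `K` formed by the edges that are not bridges. -/
def coreGraph (K : SimpleGraph V) : SimpleGraph V := K.deleteEdges {d | K.IsBridge d}

theorem coreGraph_le (K : SimpleGraph V) : coreGraph K ≤ K := SimpleGraph.deleteEdges_le _

theorem edgeSet_coreGraph (K : SimpleGraph V) : (coreGraph K).edgeSet = core K := by
  ext d
  rw [coreGraph, SimpleGraph.edgeSet_deleteEdges, mem_core_iff]
  rfl

theorem cut_coreGraph_ne_singleton (K : SimpleGraph V) (A : Set V) (d : Sym2 V) :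
    cut (coreGraph K) A ≠ {d} := by
  intro h
  have hd : d ∈ (coreGraph K).edgeSet := cut_subset_edgeSet _ A (by simp [h])
  have hb := (isBridge_iff_exists_cut hd).mpr ⟨A, h⟩
  rw [edgeSet_coreGraph, mem_core_iff] at hd
  obtain ⟨hdK, hd⟩ := hd
  rw [SimpleGraph.isBridge_iff_forall_cycle_notMem hdK] at hd
  push Not at hd
  obtain ⟨u, p, hp, hdp⟩ := hd
  have hp' : ∀ c ∈ p.edges, c ∈ (coreGraph K).edgeSet := fun c hc => by
    rw [edgeSet_coreGraph, mem_core_iff]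
    exact ⟨p.edges_subset_edgeSet hc, fun hbr => hbr.notMem_edges_of_isCycle hp hc⟩
  refine hb.notMem_edges_of_isCycle (hp.transfer hp') ?_
  rwa [SimpleGraph.Walk.edges_transfer]

theorem restrictSubgraph_component_isEdgeConnected (h : K ≤ G)
    (hK : ∀ A d, cut K A ≠ {d}) (Q : K.ConnectedComponent) :
    (restrictSubgraph h Q.supp).coe.IsEdgeConnected 2 := by
  refine Eq.mpr (congrArg (fun L : SimpleGraph Q.supp => L.IsEdgeConnected 2)
    (restrictSubgraph_coe h Q.supp)) ?_
  rw [isEdgeConnected_two_iff]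
  have hQ : cut K Q.supp = ∅ := by
    ext d
    induction d with | h x y =>
    simp only [mk_mem_cut, Set.mem_empty_iff_false, iff_false, not_and]
    intro hxy
    have := Q.mem_supp_congr_adj hxy
    tauto
  refine ⟨induce_preconnected hQ fun A hAQ hA => ?_, ?_⟩
  · rcases A.eq_empty_or_nonempty with h0 | ⟨u, hu⟩
    · exact Or.inl h0
    · refine Or.inr (hAQ.antisymm fun v hv => mem_of_reachable_of_cut_eq_empty hA ?_ hu)
      exact SimpleGraph.ConnectedComponent.exact ((hAQ hu).trans hv.symm)
  · intro d hd hbr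
    induction d with | h u v =>
    obtain ⟨A, -, hA⟩ := exists_cut_of_induce_isBridge hQ hd hbr
    exact hK A _ hA

theorem incidenceVector_core_mem [Finite V] (hKG : K ≤ G) {M : Submodule ℝ (G.edgeSet → ℝ)}
    (hM : ∀ H : G.Subgraph, H.coe.IsEdgeConnected 2 → H.edgeSet ⊆ K.edgeSet →
      incidenceVector G H.edgeSet ∈ M) : incidenceVector G (core K) ∈ M := by
  classical
  have : Fintype (coreGraph K).ConnectedComponent := Fintype.ofFinite _
  have hle : coreGraph K ≤ G := (coreGraph_le K).trans hKG
  have hsum : incidenceVector G (core K) =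
      ∑ Q : (coreGraph K).ConnectedComponent,
        incidenceVector G (restrictSubgraph hle Q.supp).edgeSet := by
    funext ⟨d, hd⟩
    induction d with | h u v =>
    rw [Finset.sum_apply]
    have hedge : ∀ Q : (coreGraph K).ConnectedComponent,
        s(u, v) ∈ (restrictSubgraph hle Q.supp).edgeSet ↔
          s(u, v) ∈ core K ∧ Q = (coreGraph K).connectedComponentMk u := by
      intro Q
      rw [← edgeSet_coreGraph, SimpleGraph.Subgraph.mem_edgeSet, SimpleGraph.mem_edgeSet]
      refine and_congr_right fun hadj => ?_
      rw [← Q.mem_supp_congr_adj hadj, and_self, SimpleGraph.ConnectedComponent.mem_supp_iff,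
        eq_comm]
    simp only [incidenceVector, Set.indicator_apply, hedge, Pi.one_apply]
    by_cases h : s(u, v) ∈ core K <;> simp [h]
  rw [hsum]
  refine Submodule.sum_mem _ fun Q _ => hM _
    (restrictSubgraph_component_isEdgeConnected hle (cut_coreGraph_ne_singleton K) Q) ?_
  intro d
  induction d with | h u v =>
  exact fun hd => coreGraph_le K hd.1

theorem incidenceVector_sdiff (G : SimpleGraph V) {X Y : Set (Sym2 V)} (h : Y ⊆ X) :
    incidenceVector G (X \ Y) = incidenceVector G X - incidenceVector G Y := by
  funext d
  exact congrFun (Set.indicator_sdiff h (1 : Sym2 V → ℝ)) d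

theorem incidenceVector_coparClass_mem [Finite V] (hKG : K ≤ G)
    {M : Submodule ℝ (G.edgeSet → ℝ)}
    (hM : ∀ H : G.Subgraph, H.coe.IsEdgeConnected 2 → H.edgeSet ⊆ K.edgeSet →
      incidenceVector G H.edgeSet ∈ M) {c : Sym2 V} (hc : c ∈ core K) :
    incidenceVector G (coparClass K c) ∈ M := by
  have hle : K.deleteEdges {c} ≤ K := SimpleGraph.deleteEdges_le _
  have h1 := incidenceVector_core_mem hKG hM
  have h2 := incidenceVector_core_mem (hle.trans hKG) fun H hH hHK =>
    hM H hH (hHK.trans (SimpleGraph.edgeSet_subset_edgeSet.mpr hle))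
  rw [core_deleteEdges_singleton, incidenceVector_sdiff G (coparClass_subset_core hc)] at h2
  simpa using M.sub_mem h1 h2

end Components

section Sides

variable {V : Type*} {K G : SimpleGraph V} {S A B : Set V}

theorem eq_or_eq_sdiff_of_cut_eq (hconn : ∀ A ⊆ S, cut K A = ∅ → A = ∅ ∨ A = S)
    (hA : A ⊆ S) (hB : B ⊆ S) (h : cut K A = cut K B) : A = B ∨ A = S \ B := by
  have h0 : cut K (A ∆ B) = ∅ := by rw [cut_symmDiff, h, symmDiff_self]; rfl
  have hsub : A ∆ B ⊆ S := fun x hx => by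
    rcases Set.mem_symmDiff.mp hx with hx | hx
    exacts [hA hx.1, hB hx.1]
  rcases hconn _ hsub h0 with h | h
  · exact Or.inl (symmDiff_eq_bot.mp h)
  · right
    ext x
    have := Set.ext_iff.mp h x
    have := @hA x
    have := @hB x
    simp only [Set.mem_symmDiff, Set.mem_sdiff] at *
    tauto

theorem subset_or_subset_of_cut_eq_pair (hconn : ∀ A ⊆ S, cut K A = ∅ → A = ∅ ∨ A = S)
    (hA : A ⊆ S) (hB : B ⊆ S) {u v : V} {d d' : Sym2 V} (hc : s(u, v) ∈ core K)
    (hd : d ≠ s(u, v)) (hd' : d' ≠ s(u, v))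
    (hcA : cut K A = {s(u, v), d}) (hcB : cut K B = {s(u, v), d'})
    (huA : u ∈ A) (huB : u ∈ B) : A ⊆ B ∨ B ⊆ A := by
  have hvA : v ∉ A := by
    have : s(u, v) ∈ cut K A := by simp [hcA]
    rw [mk_mem_cut] at this
    tauto
  have hvB : v ∉ B := by
    have : s(u, v) ∈ cut K B := by simp [hcB]
    rw [mk_mem_cut] at this
    tauto
  have aux : ∀ C D : Set V, C ⊆ S → D ⊆ S → u ∈ C → u ∈ D → cut K C = cut K D → C = D := by
    intro C D hC hD huC huD h
    rcases eq_or_eq_sdiff_of_cut_eq hconn hC hD h with h | h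
    · exact h
    · rw [h] at huC
      exact absurd huD huC.2
  by_cases hdd : d = d'
  · exact Or.inl (aux A B hA hB huA huB (by rw [hcA, hcB, hdd])).subset
  have hi : cut K (A ∩ B) ⊆ {s(u, v), d, d'} := by
    refine (cut_inter_subset K A B).trans ?_
    rw [hcA, hcB]
    grind
  have hun : cut K (A ∪ B) ⊆ {s(u, v), d, d'} := by
    refine (cut_union_subset K A B).trans ?_
    rw [hcA, hcB]
    grind
  have hci : s(u, v) ∈ cut K (A ∩ B) := by
    rw [mk_mem_cut]
    exact ⟨hc.1, by simp [huA, huB, hvA]⟩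
  have hcu : s(u, v) ∈ cut K (A ∪ B) := by
    rw [mk_mem_cut]
    exact ⟨hc.1, by simp [huA, hvA, hvB]⟩
  have hdB : d ∈ cut K (A ∩ B) → d ∉ cut K (A ∪ B) :=
    notMem_cut_union_of_mem_cut_inter (Or.inr (by rw [hcB]; simp [hd, hdd]))
  have hdA : d' ∈ cut K (A ∩ B) → d' ∉ cut K (A ∪ B) :=
    notMem_cut_union_of_mem_cut_inter (Or.inl (by rw [hcA]; simp [hd', Ne.symm hdd]))
  have hnu := hc.2 (A ∪ B)
  have hni := hc.2 (A ∩ B)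
  have key : cut K (A ∩ B) = cut K A ∨ cut K (A ∩ B) = cut K B := by
    rw [hcA, hcB]
    by_cases h1 : d ∈ cut K (A ∩ B) <;> by_cases h2 : d' ∈ cut K (A ∩ B)
    · exact absurd (Set.Subset.antisymm (fun x hx => by
        rcases hun hx with rfl | rfl | rfl
        exacts [rfl, absurd hx (hdB h1), absurd hx (hdA h2)]) (by simpa using hcu)) hnu
    · refine Or.inl (Set.Subset.antisymm (fun x hx => ?_) (Set.pair_subset hci h1))
      rcases hi hx with rfl | rfl | rfl
      exacts [Or.inl rfl, Or.inr rfl, absurd hx h2]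
    · refine Or.inr (Set.Subset.antisymm (fun x hx => ?_) (Set.pair_subset hci h2))
      rcases hi hx with rfl | rfl | rfl
      exacts [Or.inl rfl, absurd hx h1, Or.inr rfl]
    · exact absurd (Set.Subset.antisymm (fun x hx => by
        rcases hi hx with rfl | rfl | rfl
        exacts [rfl, absurd hx h1, absurd hx h2]) (by simpa using hci)) hni
  rcases key with h | h
  · left
    rw [← aux (A ∩ B) A (Set.inter_subset_left.trans hA) hA ⟨huA, huB⟩ huA h]
    exact Set.inter_subset_right
  · right
    rw [← aux (A ∩ B) B (Set.inter_subset_left.trans hA) hB ⟨huA, huB⟩ huB h]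
    exact Set.inter_subset_left

theorem disjoint_of_cut_eq_pair (hconn : ∀ A ⊆ S, cut K A = ∅ → A = ∅ ∨ A = S)
    (hA : A ⊆ S) (hB : B ⊆ S) {p u v : V} (hp : p ∈ S) (hpA : p ∉ A) (hpB : p ∉ B)
    {d d' : Sym2 V} (hd : d ∈ core K) (hd' : d' ∈ core K)
    (hdc : d ≠ s(u, v)) (hdc' : d' ≠ s(u, v))
    (hcA : cut K A = {s(u, v), d}) (hcB : cut K B = {s(u, v), d'})
    (huA : u ∈ A) (hvB : v ∈ B) : Disjoint A B := by
  have hvA : v ∉ A := by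
    have : s(u, v) ∈ cut K A := by simp [hcA]
    rw [mk_mem_cut] at this
    tauto
  have huB : u ∉ B := by
    have : s(u, v) ∈ cut K B := by simp [hcB]
    rw [mk_mem_cut] at this
    tauto
  have hdd : d ≠ d' := by
    rintro rfl
    rcases eq_or_eq_sdiff_of_cut_eq hconn hA hB (hcA.trans hcB.symm) with h | h
    · exact hvA (h ▸ hvB)
    · exact hpA (h ▸ ⟨hp, hpB⟩)
  have hi : cut K (A ∩ B) ⊆ {d, d'} := by
    have h1 := cut_inter_subset K A B
    have h2 : s(u, v) ∉ cut K (A ∩ B) := by simp [mk_mem_cut, huB, hvA]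
    rw [hcA, hcB] at h1
    grind
  have hun : cut K (A ∪ B) ⊆ {d, d'} := by
    have h1 := cut_union_subset K A B
    have h2 : s(u, v) ∉ cut K (A ∪ B) := by simp [mk_mem_cut, huA, hvB]
    rw [hcA, hcB] at h1
    grind
  rw [Set.disjoint_iff_inter_eq_empty]
  rcases Set.subset_pair_iff_eq.mp hi with h | h | h | h
  · rcases hconn _ (Set.inter_subset_left.trans hA) h with h | h
    · exact h
    · exact absurd (h ▸ hp : p ∈ A ∩ B).1 hpA
  · exact absurd h (hd.2 _)
  · exact absurd h (hd'.2 _)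
  · exfalso
    have h1 : d ∉ cut K (A ∪ B) := notMem_cut_union_of_mem_cut_inter
      (Or.inr (by rw [hcB]; simp [hdc, hdd])) (by simp [h])
    have h2 : d' ∉ cut K (A ∪ B) := notMem_cut_union_of_mem_cut_inter
      (Or.inl (by rw [hcA]; simp [hdc', hdd.symm])) (by simp [h])
    have h3 : cut K (A ∪ B) = ∅ := by grind
    rcases hconn _ (Set.union_subset hA hB) h3 with h | h
    · exact (h ▸ Or.inl huA : u ∈ (∅ : Set V)).elim
    · rcases (h ▸ hp : p ∈ A ∪ B) with h | h
      exacts [hpA h, hpB h]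

theorem notMem_cut_of_subset_compl (hS : cut K S = ∅) (hA : A ⊆ S) (hB : B ⊆ Sᶜ) {d : Sym2 V}
    (hd : d ∈ cut K A) : d ∉ cut K B := by
  induction d with | h x y =>
  have h1 : s(x, y) ∉ cut K S := by simp [hS]
  have := @hA x
  have := @hA y
  have := @hB x
  have := @hB y
  simp only [mk_mem_cut, Set.mem_compl_iff] at *
  tauto

/-- `A` is the side, inside `S` and avoiding `p`, of the cut `{c, d}` of `K`
(the empty set if `d = c`). -/
structure IsSide (K : SimpleGraph V) (S : Set V) (p : V) (c d : Sym2 V) (A : Set V) : Prop where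
  subset : A ⊆ S
  notMem : p ∉ A
  eq_empty : d = c → A = ∅
  cut_eq : d ≠ c → cut K A = {c, d}

theorem exists_isSide (hS : cut K S = ∅) {u v p : V} (hu : u ∈ S) (hp : p ∈ S)
    (hc : s(u, v) ∈ core K) {d : Sym2 V} (hd : d ∈ coparClass K s(u, v)) :
    ∃ A, IsSide K S p s(u, v) d A := by
  by_cases hdc : d = s(u, v)
  · exact ⟨∅, Set.empty_subset S, by simp, fun _ => rfl, fun h => absurd hdc h⟩
  obtain ⟨B, hB⟩ := hd.resolve_left hdc
  have hv : v ∈ S := by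
    have h1 : s(u, v) ∉ cut K S := by simp [hS]
    rw [mk_mem_cut] at h1
    have := hc.1
    rw [SimpleGraph.mem_edgeSet] at this
    tauto
  have h1 : cut K (B ∩ S) ⊆ {s(u, v), d} := by
    have := cut_inter_subset K B S
    rwa [hS, hB, Set.union_empty] at this
  have h2 : s(u, v) ∈ cut K (B ∩ S) := by
    have : s(u, v) ∈ cut K B := by simp [hB]
    simpa [mk_mem_cut, hu, hv] using this
  have h3 : cut K (B ∩ S) = {s(u, v), d} := by
    have := hc.2 (B ∩ S)
    grind
  by_cases hpB : p ∈ B ∩ S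
  · refine ⟨S ∆ (B ∩ S), fun x hx => ?_, ?_, fun h => absurd h hdc, fun _ => ?_⟩
    · rcases Set.mem_symmDiff.mp hx with hx | hx
      exacts [hx.1, hx.1.2]
    · simp [Set.mem_symmDiff, hp, hpB.1]
    · rw [cut_symmDiff, hS, h3]
      exact bot_symmDiff _
  · exact ⟨B ∩ S, Set.inter_subset_right, hpB, fun h => absurd h hdc, fun _ => h3⟩

/-- Adding back edges `F ∋ s(p, q)` of the cut `δ(S)` shrinks a coparallel class inside `S` to the
edges `d` whose sides are not met by `F`. -/
theorem mem_coparClass_deleteEdges_iff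
    (hconn : ∀ A ⊆ S, cut G A ⊆ cut G S → A = ∅ ∨ A = S)
    (hconn' : ∀ A ⊆ Sᶜ, cut G A ⊆ cut G S → A = ∅ ∨ A = Sᶜ)
    {p q : V} (hp : p ∈ S) (hq : q ∉ S) {F : Set (Sym2 V)} (hF : F ⊆ cut G S)
    (hpq : s(p, q) ∈ F) {c d : Sym2 V} (hc : c ∈ core (G.deleteEdges (cut G S)))
    (hd : d ∈ coparClass (G.deleteEdges (cut G S)) c)
    (hA : IsSide (G.deleteEdges (cut G S)) S p c d A) :
    d ∈ coparClass (G.deleteEdges (cut G S \ F)) c ↔ Disjoint (cut G A) F := by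
  by_cases hdc : d = c
  · rw [hA.eq_empty hdc, cut_empty]
    simp [hdc, self_mem_coparClass]
  have hcS : c ∉ cut G S := by
    have := hc.1
    rw [SimpleGraph.edgeSet_deleteEdges] at this
    exact this.2
  have hdS : d ∉ cut G S := by
    have := (coparClass_subset_core hc hd).1
    rw [SimpleGraph.edgeSet_deleteEdges] at this
    exact this.2
  have hcut := hA.cut_eq hdc
  constructor
  · intro h
    obtain ⟨B, hB⟩ := h.resolve_left hdc
    wlog hpB : p ∉ B generalizing B
    · exact this Bᶜ (by rwa [cut_compl]) (by simpa using hpB)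
    rw [cut_deleteEdges] at hB
    have hBF : Disjoint (cut G B) F := by
      rw [Set.disjoint_left]
      intro f hf hfF
      have h1 : f ∈ cut G B \ (cut G S \ F) := ⟨hf, fun h => h.2 hfF⟩
      rw [hB] at h1
      rcases h1 with rfl | rfl
      exacts [hcS (hF hfF), hdS (hF hfF)]
    have hqB : q ∉ B := by
      have h1 := Set.disjoint_right.mp hBF hpq
      rw [mk_mem_cut] at h1
      have h2 := (hF hpq).1
      rw [SimpleGraph.mem_edgeSet] at h2
      tauto
    have hB0 : cut (G.deleteEdges (cut G S)) B = {c, d} := by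
      rw [cut_deleteEdges]
      grind
    have hS0 : cut (G.deleteEdges (cut G S)) S = ∅ := by rw [cut_deleteEdges, Set.sdiff_self]
    have hBS : B ∩ Sᶜ = ∅ := by
      have h1 : cut (G.deleteEdges (cut G S)) (B ∩ Sᶜ) ⊆ cut (G.deleteEdges (cut G S)) A := by
        refine (cut_inter_subset _ _ _).trans ?_
        rw [cut_compl, hS0, hB0, hcut, Set.union_empty]
      have h2 : cut (G.deleteEdges (cut G S)) (B ∩ Sᶜ) = ∅ :=
        Set.eq_empty_of_forall_notMem fun x hx =>
          notMem_cut_of_subset_compl hS0 hA.subset Set.inter_subset_right (h1 hx) hx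
      rw [cut_deleteEdges, Set.sdiff_eq_empty] at h2
      rcases hconn' _ Set.inter_subset_right h2 with h | h
      · exact h
      · exact absurd (h.ge hq).1 hqB
    have hBsub : B ⊆ S := fun x hx => by
      by_contra hxS
      exact Set.eq_empty_iff_forall_notMem.mp hBS x ⟨hx, hxS⟩
    rcases eq_or_eq_sdiff_of_cut_eq (K := G.deleteEdges (cut G S)) (fun C hC h0 => hconn C hC (by
        rwa [cut_deleteEdges, Set.sdiff_eq_empty] at h0)) hBsub hA.subset
        (hB0.trans hcut.symm) with h | h
    · exact h ▸ hBF
    · exact absurd (h.ge ⟨hp, hA.notMem⟩) hpB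
  · intro h
    refine Or.inr ⟨A, ?_⟩
    rw [cut_deleteEdges] at hcut ⊢
    rw [← hcut]
    ext x
    have : x ∈ cut G A → x ∉ F := fun hx => Set.disjoint_left.mp h hx
    simp only [Set.mem_sdiff]
    tauto

theorem coparClass_deleteEdges_subset {D E : Set (Sym2 V)} (hDE : D ⊆ E) {c : Sym2 V}
    (hc : c ∈ core (G.deleteEdges E)) :
    coparClass (G.deleteEdges D) c ⊆ coparClass (G.deleteEdges E) c := by
  rintro d (rfl | ⟨A, hA⟩)
  · exact self_mem_coparClass _ _
  · right
    refine ⟨A, ?_⟩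
    have h1 := hc.2 A
    have h2 := hc.1
    rw [SimpleGraph.edgeSet_deleteEdges] at h2
    rw [cut_deleteEdges] at hA h1 ⊢
    have h3 : ∀ x, x ∈ cut G A ∧ x ∉ D ↔ x = c ∨ x = d := fun x => Set.ext_iff.mp hA x
    have h4 : cut G A \ E ⊆ {c, d} := fun x hx => (h3 x).mp ⟨hx.1, fun h => hx.2 (hDE h)⟩
    have h5 : c ∈ cut G A \ E := ⟨((h3 c).mpr (Or.inl rfl)).1, h2.2⟩
    grind

end Sides

section ClassVectors

variable {V : Type*} {G : SimpleGraph V} {S : Set V}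

theorem mem_cut_of_subset {A B : Set V} (hAB : A ⊆ B) (hB : B ⊆ S) {f : Sym2 V}
    (hf : f ∈ cut G S) (hfA : f ∈ cut G A) : f ∈ cut G B := by
  induction f with | h x y =>
  have := @hAB x
  have := @hAB y
  have := @hB x
  have := @hB y
  simp only [mk_mem_cut] at *
  tauto

theorem not_disjoint_of_mem_cut {A B : Set V} (hA : A ⊆ S) (hB : B ⊆ S) {f : Sym2 V}
    (hf : f ∈ cut G S) (hfA : f ∈ cut G A) (hfB : f ∈ cut G B) : ¬ Disjoint A B := by
  rw [Set.not_disjoint_iff]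
  induction f with | h x y =>
  have := @hA x
  have := @hA y
  have := @hB x
  have := @hB y
  simp only [mk_mem_cut] at *
  by_cases hx : x ∈ S
  · exact ⟨x, by tauto, by tauto⟩
  · exact ⟨y, by tauto, by tauto⟩

/-- If `M` contains the incidence vectors of all `2`-edge-connected subgraphs meeting `δ(S)` only
in `s(p, q)` and one more edge, then `M` contains the incidence vector of the coparallel class of
every edge of `G[S]` that is not a bridge of `G[S]`. -/
theorem incidenceVector_coparClass_mem_of_mem_core [Finite V]
    (hconn : ∀ A ⊆ S, cut G A ⊆ cut G S → A = ∅ ∨ A = S)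
    (hconn' : ∀ A ⊆ Sᶜ, cut G A ⊆ cut G S → A = ∅ ∨ A = Sᶜ)
    {p q : V} (hp : p ∈ S) (hq : q ∉ S) (hpq : s(p, q) ∈ cut G S)
    {M : Submodule ℝ (G.edgeSet → ℝ)}
    (hM : ∀ f ∈ cut G S, ∀ H : G.Subgraph, H.coe.IsEdgeConnected 2 →
      cut G S ∩ H.edgeSet ⊆ {s(p, q), f} → incidenceVector G H.edgeSet ∈ M)
    {u v : V} (hu : u ∈ S) (hc : s(u, v) ∈ core (G.deleteEdges (cut G S))) :
    incidenceVector G (coparClass G s(u, v)) ∈ M := by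
  set K := G.deleteEdges (cut G S) with hK
  have hS0 : cut K S = ∅ := by rw [hK, cut_deleteEdges, Set.sdiff_self]
  have hconnK : ∀ A ⊆ S, cut K A = ∅ → A = ∅ ∨ A = S := fun A hA h0 =>
    hconn A hA (by rwa [hK, cut_deleteEdges, Set.sdiff_eq_empty] at h0)
  set C := coparClass K s(u, v) with hC
  have hCcore : C ⊆ core K := coparClass_subset_core hc
  have hCmem : incidenceVector G C ∈ M := by
    refine incidenceVector_coparClass_mem (SimpleGraph.deleteEdges_le _) (fun H hH hHK => ?_) hc
    refine hM _ hpq H hH fun d hd => ?_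
    have := hHK hd.2
    rw [SimpleGraph.edgeSet_deleteEdges] at this
    exact absurd hd.1 this.2
  have hpair : ∀ f ∈ cut G S,
      incidenceVector G (coparClass (G.deleteEdges (cut G S \ {s(p, q), f})) s(u, v)) ∈ M := by
    intro f hf
    refine incidenceVector_coparClass_mem (SimpleGraph.deleteEdges_le _) (fun H hH hHK => ?_)
      (core_mono (SimpleGraph.deleteEdges_anti Set.sdiff_subset) hc)
    refine hM f hf H hH fun d hd => ?_
    have := hHK hd.2
    rw [SimpleGraph.edgeSet_deleteEdges] at this
    by_contra h
    exact this.2 ⟨hd.1, h⟩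
  have hside : ∀ d ∈ C, ∃ A, IsSide K S p s(u, v) d A := fun d hd =>
    exists_isSide hS0 hu hp hc hd
  choose! A hA using hside
  have hbad : ∀ z z', s(u, v) = s(z, z') → incidenceVector G
      {d ∈ C | z ∈ A d ∧ ¬ Disjoint (cut G (A d)) (cut G S)} ∈ M := by
    intro z z' hz
    set N := {d ∈ C | z ∈ A d ∧ ¬ Disjoint (cut G (A d)) (cut G S)} with hN
    rcases N.eq_empty_or_nonempty with h0 | hne
    · rw [h0]
      have : incidenceVector G ∅ = 0 := by
        funext d
        simp [incidenceVector]
      rw [this]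
      exact M.zero_mem
    · obtain ⟨d, hdN, hdmin⟩ : ∃ d ∈ N, ∀ d' ∈ N, (A d).ncard ≤ (A d').ncard := by
        obtain ⟨d, hd, hmin⟩ := Set.exists_min_image N (fun d => (A d).ncard) (Set.toFinite N) hne
        exact ⟨d, hd, hmin⟩
      have hneq : ∀ d' ∈ C, ¬ Disjoint (cut G (A d')) (cut G S) → d' ≠ s(u, v) := by
        intro d' hd' hdis heq
        rw [(hA d' hd').eq_empty heq, cut_empty] at hdis
        exact hdis (Set.empty_disjoint _)
      obtain ⟨hdC, hzd, hdS⟩ := hdN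
      obtain ⟨f, hfd, hfS⟩ := Set.not_disjoint_iff.mp hdS
      have hdc := hneq d hdC hdS
      have hNeq : N = C \ coparClass (G.deleteEdges (cut G S \ {s(p, q), f})) s(u, v) := by
        ext d'
        refine ⟨fun hd' => ?_, fun hd' => ?_⟩
        · have hd'C := hd'.1
          refine ⟨hd'C, fun hcl => ?_⟩
          rw [mem_coparClass_deleteEdges_iff hconn hconn' hp hq (Set.pair_subset hpq hfS)
            (by simp) hc hd'C (hA d' hd'C)] at hcl
          refine Set.disjoint_left.mp hcl ?_ (by simp : f ∈ ({s(p, q), f} : Set (Sym2 V)))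
          refine mem_cut_of_subset ?_ (hA d' hd'C).subset hfS hfd
          have hd'c := hneq d' hd'C hd'.2.2
          rcases subset_or_subset_of_cut_eq_pair hconnK (hA d hdC).subset (hA d' hd'C).subset
            (hz ▸ hc) (hz ▸ hdc) (hz ▸ hd'c) (hz ▸ (hA d hdC).cut_eq hdc)
            (hz ▸ (hA d' hd'C).cut_eq hd'c) hzd hd'.2.1 with h | h
          · exact h
          · exact (Set.eq_of_subset_of_ncard_le h (hdmin d' hd') (Set.toFinite _)).ge
        · obtain ⟨hd'C, hcl⟩ := hd'
          rw [mem_coparClass_deleteEdges_iff hconn hconn' hp hq (Set.pair_subset hpq hfS)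
            (by simp) hc hd'C (hA d' hd'C)] at hcl
          obtain ⟨g, hgd', hg⟩ := Set.not_disjoint_iff.mp hcl
          have hpd' : s(p, q) ∉ cut G (A d') := by
            have h1 := (hA d' hd'C).notMem
            have h2 : q ∉ A d' := fun h => hq ((hA d' hd'C).subset h)
            simp [mk_mem_cut, h1, h2]
          have hfd' : f ∈ cut G (A d') := by
            rcases hg with rfl | rfl
            exacts [absurd hgd' hpd', hgd']
          have hdis : ¬ Disjoint (cut G (A d')) (cut G S) :=
            Set.not_disjoint_iff.mpr ⟨f, hfd', hfS⟩
          refine ⟨hd'C, ?_, hdis⟩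
          by_contra hz'
          have hd'c := hneq d' hd'C hdis
          have hcut := (hA d' hd'C).cut_eq hd'c
          have hz'mem : z' ∈ A d' := by
            have : s(z, z') ∈ cut K (A d') := by rw [hcut, hz]; simp
            rw [mk_mem_cut] at this
            tauto
          refine not_disjoint_of_mem_cut (hA d hdC).subset (hA d' hd'C).subset hfS hfd hfd' ?_
          exact disjoint_of_cut_eq_pair hconnK (hA d hdC).subset (hA d' hd'C).subset hp
            (hA d hdC).notMem (hA d' hd'C).notMem (hCcore hdC) (hCcore hd'C) (hz ▸ hdc)
            (hz ▸ hd'c) (hz ▸ (hA d hdC).cut_eq hdc) (hz ▸ hcut) hzd hz'mem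
      rw [hNeq, incidenceVector_sdiff G (coparClass_deleteEdges_subset Set.sdiff_subset hc)]
      exact M.sub_mem hCmem (hpair f hfS)
  have hG0 : G.deleteEdges (cut G S \ cut G S) = G := by simp
  have hsub : coparClass G s(u, v) ⊆ C := by
    have := coparClass_deleteEdges_subset (D := cut G S \ cut G S) Set.sdiff_subset hc
    rwa [hG0] at this
  have hmem : ∀ d ∈ C, d ∈ coparClass G s(u, v) ↔ Disjoint (cut G (A d)) (cut G S) := by
    intro d hd
    have := mem_coparClass_deleteEdges_iff hconn hconn' hp hq subset_rfl hpq hc hd (hA d hd)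
    rwa [hG0] at this
  have hsum : incidenceVector G (coparClass G s(u, v)) = incidenceVector G C -
      incidenceVector G {d ∈ C | u ∈ A d ∧ ¬ Disjoint (cut G (A d)) (cut G S)} -
      incidenceVector G {d ∈ C | v ∈ A d ∧ ¬ Disjoint (cut G (A d)) (cut G S)} := by
    rw [← incidenceVector_sdiff G (fun d hd => hd.1), ← incidenceVector_sdiff]
    · congr 1
      ext d
      by_cases hd : d ∈ C
      · rw [hmem d hd]
        by_cases hdis : Disjoint (cut G (A d)) (cut G S)
        · simp [hd, hdis]
        · have hdc : d ≠ s(u, v) := by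
            intro heq
            rw [(hA d hd).eq_empty heq, cut_empty] at hdis
            exact hdis (Set.empty_disjoint _)
          have : s(u, v) ∈ cut K (A d) := by simp [(hA d hd).cut_eq hdc]
          rw [mk_mem_cut] at this
          simp only [hdis, hd, Set.mem_sdiff, Set.mem_ofPred_eq]
          tauto
      · have : d ∉ coparClass G s(u, v) := fun h => hd (hsub h)
        simp [hd, this]
    · rintro d ⟨hd, hvd, hdis⟩
      refine ⟨hd, fun h => ?_⟩
      have hdc : d ≠ s(u, v) := by
        intro heq
        rw [(hA d hd).eq_empty heq] at hvd
        exact hvd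
      have : s(u, v) ∈ cut K (A d) := by simp [(hA d hd).cut_eq hdc]
      rw [mk_mem_cut] at this
      exact this.2.mp h.2.1 hvd
  rw [hsum]
  exact M.sub_mem (M.sub_mem hCmem (hbad u v rfl)) (hbad v u Sym2.eq_swap)

/-- Two edges of a minimal cut are not bridges of the graph without the rest of the cut. -/
theorem mem_core_deleteEdges_cut_sdiff_pair
    (hconn : ∀ A ⊆ S, cut G A ⊆ cut G S → A = ∅ ∨ A = S)
    (hconn' : ∀ A ⊆ Sᶜ, cut G A ⊆ cut G S → A = ∅ ∨ A = Sᶜ)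
    {e f : Sym2 V} (he : e ∈ cut G S) (hf : f ∈ cut G S) (hef : e ≠ f) :
    e ∈ core (G.deleteEdges (cut G S \ {e, f})) := by
  refine ⟨by simp [SimpleGraph.edgeSet_deleteEdges, he.1], fun A hA => ?_⟩
  rw [cut_deleteEdges] at hA
  have hA' : ∀ x, x ∈ cut G A ∧ x ∉ cut G S \ {e, f} ↔ x = e := fun x => Set.ext_iff.mp hA x
  have heA : e ∈ cut G A := ((hA' e).mpr rfl).1
  have hfA : f ∉ cut G A := fun h => hef ((hA' f).mp ⟨h, by simp⟩).symm
  have hsub : cut G A ⊆ cut G S := fun x hx => by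
    by_contra hxS
    exact hxS ((hA' x).mp ⟨hx, fun h => hxS h.1⟩ ▸ he)
  have h1 := hconn (A ∩ S) Set.inter_subset_right
    ((cut_inter_subset G A S).trans (Set.union_subset hsub subset_rfl))
  have h2 := hconn' (A ∩ Sᶜ) Set.inter_subset_right
    ((cut_inter_subset G A Sᶜ).trans (Set.union_subset hsub (cut_compl G S).subset))
  obtain ⟨heG, p, hp, q, hq, rfl⟩ := he
  obtain ⟨hfG, p', hp', q', hq', rfl⟩ := hf
  have hiff : ∀ (T : Set V) (x y : V), x ∈ T → y ∈ T → (A ∩ T = ∅ ∨ A ∩ T = T) →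
      (x ∈ A ↔ y ∈ A) := by
    rintro T x y hx hy (h | h)
    · have h' := Set.eq_empty_iff_forall_notMem.mp h
      exact ⟨fun hxA => absurd ⟨hxA, hx⟩ (h' x), fun hyA => absurd ⟨hyA, hy⟩ (h' y)⟩
    · exact ⟨fun _ => (h.ge hy).1, fun _ => (h.ge hx).1⟩
  have hpp := hiff S p p' hp hp' h1
  have hqq := hiff Sᶜ q q' hq hq' h2
  rw [mk_mem_cut] at heA hfA
  rw [SimpleGraph.mem_edgeSet] at hfG
  tauto

theorem eq_empty_or_eq_of_cut_subset (hG : G.Preconnected) (hS : S ≠ Set.univ)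
    (hmin : IsMinimalCut G (cut G S)) {A : Set V} (hA : A ⊆ S) (h : cut G A ⊆ cut G S) :
    A = ∅ ∨ A = S := by
  rcases A.eq_empty_or_nonempty with h0 | hne
  · exact Or.inl h0
  right
  have hAu : A ≠ Set.univ := fun hu => hS (Set.eq_univ_of_univ_subset (hu ▸ hA))
  have hcut := cut_nonempty hG hne hAu
  have heq : cut G A = cut G S := h.antisymm (hmin.2 ⟨isCut_cut hcut, hcut⟩ h)
  by_contra hAS
  have hd : (S \ A).Nonempty := Set.sdiff_nonempty.mpr fun h => hAS (hA.antisymm h)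
  have hdu : S \ A ≠ Set.univ :=
    fun hu => hS (Set.eq_univ_of_univ_subset (hu ▸ Set.sdiff_subset))
  have h1 := cut_nonempty hG hd hdu
  have h2 : S \ A = S ∆ A := by rw [Set.symmDiff_def, Set.sdiff_eq_empty.mpr hA, Set.union_empty]
  rw [h2, cut_symmDiff, heq, symmDiff_self] at h1
  exact Set.not_nonempty_empty h1

end ClassVectors

section Polyhedral

variable {E : Type*} [AddCommGroup E] [Module ℝ E]

theorem vectorSpan_eq_span_of_zero_mem {X : Set E} (h0 : (0 : E) ∈ X) :
    vectorSpan ℝ X = Submodule.span ℝ X := by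
  rw [vectorSpan_eq_span_vsub_set_right ℝ h0]
  simp

theorem span_convexHull_eq (X : Set E) :
    Submodule.span ℝ (convexHull ℝ X) = Submodule.span ℝ X :=
  (Submodule.span_le.mpr
    (convexHull_min Submodule.subset_span (Submodule.span ℝ X).convex)).antisymm
    (Submodule.span_mono (subset_convexHull ℝ X))

/-- A point of a convex hull at which a valid linear inequality is tight lies in every subspace
containing the tight generators. -/
theorem map_nonpos_and_mem_of_mem_convexHull {X : Set E} {a : E →ₗ[ℝ] ℝ} (hX : ∀ x ∈ X, a x ≤ 0)
    {Q : Submodule ℝ E} (hQ : ∀ x ∈ X, a x = 0 → x ∈ Q) {x : E} (hx : x ∈ convexHull ℝ X) :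
    a x ≤ 0 ∧ (a x = 0 → x ∈ Q) := by
  have hconv : Convex ℝ {x : E | a x ≤ 0 ∧ (a x = 0 → x ∈ Q)} := by
    rintro x ⟨hx, hxQ⟩ y ⟨hy, hyQ⟩ s t hs ht -
    have h1 : s * a x ≤ 0 := mul_nonpos_of_nonneg_of_nonpos hs hx
    have h2 : t * a y ≤ 0 := mul_nonpos_of_nonneg_of_nonpos ht hy
    simp only [Set.mem_ofPred_eq, map_add, map_smul, smul_eq_mul]
    refine ⟨by linarith, fun h => Q.add_mem ?_ ?_⟩
    · rcases mul_eq_zero.mp (by linarith : s * a x = 0) with h | h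
      · simp [h]
      · exact Q.smul_mem s (hxQ h)
    · rcases mul_eq_zero.mp (by linarith : t * a y = 0) with h | h
      · simp [h]
      · exact Q.smul_mem t (hyQ h)
  exact convexHull_min (t := {x : E | a x ≤ 0 ∧ (a x = 0 → x ∈ Q)}) (fun x hx => ⟨hX x hx, hQ x hx⟩) hconv hx

theorem definesFacet_convexHull_iff [FiniteDimensional ℝ E] {X : Set E} {a : E →ₗ[ℝ] ℝ}
    (h0 : (0 : E) ∈ X) (hX : ∀ x ∈ X, a x ≤ 0) {w : E} (hw : w ∈ Submodule.span ℝ X)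
    (haw : a w ≠ 0) :
    DefinesFacet (convexHull ℝ X) a 0 ↔
      Submodule.span ℝ X ⊓ LinearMap.ker a ≤ Submodule.span ℝ {x ∈ X | a x = 0} := by
  set W := Submodule.span ℝ X
  set N := Submodule.span ℝ {x ∈ X | a x = 0}
  have hvalid : ∀ x ∈ convexHull ℝ X, a x ≤ 0 ∧ (a x = 0 → x ∈ N) := fun x hx =>
    map_nonpos_and_mem_of_mem_convexHull hX
      (fun y hy hay => Submodule.subset_span (show y ∈ {x ∈ X | a x = 0} from ⟨hy, hay⟩)) hx
  have h0P : (0 : E) ∈ convexHull ℝ X := subset_convexHull ℝ X h0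
  have h0F : (0 : E) ∈ face (convexHull ℝ X) a 0 := ⟨h0P, map_zero a⟩
  have hP : vectorSpan ℝ (convexHull ℝ X) = W := by
    rw [vectorSpan_eq_span_of_zero_mem h0P, span_convexHull_eq]
  have hF : vectorSpan ℝ (face (convexHull ℝ X) a 0) = N := by
    rw [vectorSpan_eq_span_of_zero_mem h0F]
    refine le_antisymm (Submodule.span_le.mpr fun x hx => (hvalid x hx.1).2 hx.2)
      (Submodule.span_mono fun x hx => ⟨subset_convexHull ℝ X hx.1, hx.2⟩)
  have hNle : N ≤ W ⊓ LinearMap.ker a :=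
    le_inf (Submodule.span_mono fun x hx => hx.1) (Submodule.span_le.mpr fun x hx => hx.2)
  have hrank : Module.finrank ℝ (W ⊓ LinearMap.ker a : Submodule ℝ E) + 1 =
      Module.finrank ℝ W := by
    have hne : a.domRestrict W ≠ 0 := fun h =>
      haw (by simpa using LinearMap.congr_fun h ⟨w, hw⟩)
    rw [← Module.Dual.finrank_ker_add_one_of_ne_zero hne, LinearMap.ker_domRestrict]
    congr 1
    rw [← (Submodule.comapSubtypeEquivOfLe (inf_le_left :
      W ⊓ LinearMap.ker a ≤ W)).finrank_eq]
    rw [Submodule.comap_inf, Submodule.comap_subtype_self, top_inf_eq]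
  unfold DefinesFacet affDim
  rw [hP, hF, ← hrank]
  constructor
  · rintro ⟨-, -, h⟩
    exact (Submodule.eq_of_le_of_finrank_eq hNle (by omega)).ge
  · intro h
    exact ⟨fun x hx => (hvalid x hx).1, ⟨0, h0F⟩, by rw [le_antisymm hNle h]⟩

end Polyhedral

section EdgeSums

variable {V : Type*} {G : SimpleGraph V}

theorem incidenceVector_of_mem {F : Set (Sym2 V)} {d : G.edgeSet} (h : (d : Sym2 V) ∈ F) :
    incidenceVector G F d = 1 := Set.indicator_of_mem h 1

theorem incidenceVector_of_notMem {F : Set (Sym2 V)} {d : G.edgeSet} (h : (d : Sym2 V) ∉ F) :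
    incidenceVector G F d = 0 := Set.indicator_of_notMem h 1

variable [Fintype G.edgeSet]

theorem edgeSum_apply (F : Set (Sym2 V)) [DecidablePred fun f : G.edgeSet => (f : Sym2 V) ∈ F]
    (x : G.edgeSet → ℝ) :
    edgeSum G F x = ∑ f ∈ Finset.univ.filter (fun f : G.edgeSet => (f : Sym2 V) ∈ F), x f := by
  rw [edgeSum, LinearMap.sum_apply]
  exact Finset.sum_congr (by ext; simp) fun _ _ => rfl

theorem edgeSum_incidenceVector {F : Set (Sym2 V)} (hF : F ⊆ G.edgeSet) (X : Set (Sym2 V)) :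
    edgeSum G F (incidenceVector G X) = ((F ∩ X).ncard : ℝ) := by
  classical
  rw [edgeSum_apply, Finset.sum_filter]
  have h1 : ∀ f : G.edgeSet, (if (f : Sym2 V) ∈ F then incidenceVector G X f else 0) =
      if (f : Sym2 V) ∈ F ∩ X then 1 else 0 := by
    intro f
    by_cases hf : (f : Sym2 V) ∈ F <;> by_cases hx : (f : Sym2 V) ∈ X <;>
      simp [hf, hx, incidenceVector]
  rw [Finset.sum_congr rfl fun f _ => h1 f, Finset.sum_boole]
  congr 1
  have h2 : (F ∩ X).ncard = (Subtype.val ⁻¹' (F ∩ X) : Set G.edgeSet).ncard := by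
    rw [← Set.ncard_image_of_injective _ Subtype.val_injective, Subtype.image_preimage_val,
      Set.inter_eq_right.mpr (Set.inter_subset_left.trans hF)]
  rw [h2, Set.ncard_eq_toFinset_card']
  congr 1
  ext f
  rw [Finset.mem_filter, Set.mem_toFinset]
  simp

/-- A vector that is constant on coparallel classes is a combination of their incidence
vectors. -/
theorem mem_of_constant_on_coparClass {M : Submodule ℝ (G.edgeSet → ℝ)} {x : G.edgeSet → ℝ}
    (hx : ∀ c d : G.edgeSet, (d : Sym2 V) ∈ coparClass G c → x d = x c)
    (hM : ∀ c : G.edgeSet, x c = 0 ∨ incidenceVector G (coparClass G c) ∈ M) : x ∈ M := by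
  classical
  let n : G.edgeSet → ℕ := fun c =>
    (Finset.univ.filter fun d : G.edgeSet => (d : Sym2 V) ∈ coparClass G c).card
  have hsum : x = ∑ c : G.edgeSet, (x c / n c) • incidenceVector G (coparClass G c) := by
    funext d
    have hterm : ∀ c : G.edgeSet, ((x c / n c) • incidenceVector G (coparClass G c)) d =
        if (c : Sym2 V) ∈ coparClass G d then x d / n d else 0 := by
      intro c
      by_cases hc : (c : Sym2 V) ∈ coparClass G d
      · have hd := coparClass_symm hc
        have hn : n c = n d := by
          refine congrArg Finset.card (Finset.filter_congr fun b _ => ?_)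
          exact ⟨fun hb => coparClass_trans hc hb, fun hb => coparClass_trans hd hb⟩
        simp [hc, incidenceVector_of_mem hd, hx d c hc, hn]
      · have hd : (d : Sym2 V) ∉ coparClass G c := fun h => hc (coparClass_symm h)
        simp [hc, incidenceVector_of_notMem hd]
    have hpos : (n d : ℝ) ≠ 0 := by
      refine Nat.cast_ne_zero.mpr (Finset.card_ne_zero.mpr ⟨d, ?_⟩)
      simp [self_mem_coparClass]
    rw [Finset.sum_apply, Finset.sum_congr rfl fun c _ => hterm c, ← Finset.sum_filter,
      Finset.sum_const, nsmul_eq_mul]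
    exact (mul_div_cancel₀ (x d) hpos).symm
  rw [hsum]
  refine Submodule.sum_mem _ fun c _ => ?_
  rcases hM c with h | h
  · simp [h]
  · exact M.smul_mem _ h

end EdgeSums

section Facet

variable {V : Type*} {G : SimpleGraph V}

/-- The incidence vectors of the `2`-edge-connected subgraphs. -/
def vertexVectors (G : SimpleGraph V) : Set (G.edgeSet → ℝ) :=
  {x | ∃ H : G.Subgraph, H.coe.IsEdgeConnected 2 ∧ x = incidenceVector G H.edgeSet}

theorem zero_mem_vertexVectors (G : SimpleGraph V) : 0 ∈ vertexVectors G := by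
  refine ⟨⊥, ?_, ?_⟩
  · intro u
    exact (Set.notMem_empty _ u.2).elim
  · funext d
    simp [incidenceVector]

theorem incidenceVector_coparClass_mem_span [Finite V] {c : Sym2 V} (hc : c ∈ core G) :
    incidenceVector G (coparClass G c) ∈ Submodule.span ℝ (vertexVectors G) :=
  incidenceVector_coparClass_mem le_rfl
    (fun H hH _ => Submodule.subset_span (show _ ∈ vertexVectors G from ⟨H, hH, rfl⟩)) hc

theorem apply_eq_of_mem_span {x : G.edgeSet → ℝ}
    (hx : x ∈ Submodule.span ℝ (vertexVectors G)) {c d : G.edgeSet}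
    (hd : (d : Sym2 V) ∈ coparClass G c) : x d = x c := by
  have hle : Submodule.span ℝ (vertexVectors G) ≤ LinearMap.ker
      (LinearMap.proj (R := ℝ) (φ := fun _ : G.edgeSet => ℝ) d - LinearMap.proj c) := by
    rw [Submodule.span_le]
    rintro _ ⟨H, hH, rfl⟩
    simp only [SetLike.mem_coe, LinearMap.mem_ker, LinearMap.sub_apply, LinearMap.proj_apply,
      sub_eq_zero]
    rcases hd with h | ⟨A, hA⟩
    · rw [Subtype.ext h]
    · have h1 := cut_inter_edgeSet_ne_singleton hH A c
      have h2 := cut_inter_edgeSet_ne_singleton hH A d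
      rw [hA] at h1 h2
      by_cases hcH : (c : Sym2 V) ∈ H.edgeSet <;> by_cases hdH : (d : Sym2 V) ∈ H.edgeSet
      · rw [incidenceVector_of_mem hcH, incidenceVector_of_mem hdH]
      · refine absurd ?_ h1
        grind
      · refine absurd ?_ h2
        grind
      · rw [incidenceVector_of_notMem hcH, incidenceVector_of_notMem hdH]
  have := hle hx
  rwa [LinearMap.mem_ker, LinearMap.sub_apply, LinearMap.proj_apply, LinearMap.proj_apply,
    sub_eq_zero] at this

variable [Fintype G.edgeSet]

/-- The left-hand side `x_e - x(D \ {e})` of an asymmetric cut inequality. -/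
noncomputable abbrev cutForm (e : G.edgeSet) (D : Set (Sym2 V)) : (G.edgeSet → ℝ) →ₗ[ℝ] ℝ :=
  LinearMap.proj e - edgeSum G (D \ {(e : Sym2 V)})

theorem cutForm_incidenceVector {e : G.edgeSet} {D : Set (Sym2 V)} (hD : D ⊆ G.edgeSet)
    (X : Set (Sym2 V)) : cutForm e D (incidenceVector G X) =
      incidenceVector G X e - (((D ∩ X) \ {(e : Sym2 V)}).ncard : ℝ) := by
  rw [cutForm, LinearMap.sub_apply, LinearMap.proj_apply,
    edgeSum_incidenceVector (Set.sdiff_subset.trans hD), Set.inter_comm, ← Set.inter_sdiff_assoc,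
    Set.inter_comm X D]

theorem cutForm_nonpos {e : G.edgeSet} {D X : Set (Sym2 V)} (hD : D ⊆ G.edgeSet)
    (he : (e : Sym2 V) ∈ D) (hX : D ∩ X ≠ {(e : Sym2 V)}) :
    cutForm e D (incidenceVector G X) ≤ 0 := by
  rw [cutForm_incidenceVector hD]
  by_cases heX : (e : Sym2 V) ∈ X
  · rw [incidenceVector_of_mem heX, sub_nonpos]
    have hfin : ((D ∩ X) \ {(e : Sym2 V)}).Finite :=
      (Set.toFinite G.edgeSet).subset fun d hd => hD hd.1.1
    have : 0 < ((D ∩ X) \ {(e : Sym2 V)}).ncard := by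
      rw [Set.ncard_pos hfin, Set.sdiff_nonempty]
      exact fun h => hX (h.antisymm (Set.singleton_subset_iff.mpr ⟨he, heX⟩))
    exact_mod_cast this
  · rw [incidenceVector_of_notMem heX, zero_sub]
    simp

theorem cutForm_eq_zero {e : G.edgeSet} {f : Sym2 V} {D X : Set (Sym2 V)} (hD : D ⊆ G.edgeSet)
    (he : (e : Sym2 V) ∈ D) (hX : ∀ d, D ∩ X ≠ {d}) (hf : D ∩ X ⊆ {(e : Sym2 V), f}) :
    cutForm e D (incidenceVector G X) = 0 := by
  rw [cutForm_incidenceVector hD]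
  rcases Set.subset_pair_iff_eq.mp hf with h | h | h | h
  · have heX : (e : Sym2 V) ∉ X := fun heX =>
      Set.eq_empty_iff_forall_notMem.mp h e ⟨he, heX⟩
    rw [h, incidenceVector_of_notMem heX]
    simp
  · exact absurd h (hX _)
  · exact absurd h (hX _)
  · have hef : f ≠ e := by
      rintro rfl
      exact hX _ (h.trans (Set.pair_eq_singleton _))
    have heX : (e : Sym2 V) ∈ X := (h.ge (Or.inl rfl)).2
    rw [h, incidenceVector_of_mem heX, Set.insert_sdiff_of_mem _ (Set.mem_singleton _),
      Set.sdiff_singleton_eq_self (by simpa using hef.symm)]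
    simp

theorem eq_empty_or_eq_pair_of_cutForm_eq_zero {e : G.edgeSet} {D X : Set (Sym2 V)}
    (hD : D ⊆ G.edgeSet) (he : (e : Sym2 V) ∈ D)
    (h : cutForm e D (incidenceVector G X) = 0) :
    D ∩ X = ∅ ∨ ∃ f, f ≠ (e : Sym2 V) ∧ D ∩ X = {(e : Sym2 V), f} := by
  rw [cutForm_incidenceVector hD] at h
  have hfin : ((D ∩ X) \ {(e : Sym2 V)}).Finite :=
    (Set.toFinite G.edgeSet).subset fun d hd => hD hd.1.1
  by_cases heX : (e : Sym2 V) ∈ X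
  · right
    rw [incidenceVector_of_mem heX, sub_eq_zero] at h
    obtain ⟨f, hf⟩ := Set.ncard_eq_one.mp (by exact_mod_cast h.symm)
    have hfe : f ∈ (D ∩ X) \ {(e : Sym2 V)} := by simp [hf]
    refine ⟨f, hfe.2, ?_⟩
    have hmem : (e : Sym2 V) ∈ D ∩ X := ⟨he, heX⟩
    rw [← Set.insert_sdiff_self_of_mem hmem, hf]
  · left
    rw [incidenceVector_of_notMem heX, zero_sub, neg_eq_zero, Nat.cast_eq_zero,
      Set.ncard_eq_zero hfin, Set.sdiff_singleton_eq_self (fun h => heX h.2)] at h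
    exact h

/-- The span of the incidence vectors of the `2`-edge-connected subgraphs satisfying the asymmetric
cut inequality with equality. -/
noncomputable abbrev tightSpan (e : G.edgeSet) (D : Set (Sym2 V)) :
    Submodule ℝ (G.edgeSet → ℝ) :=
  Submodule.span ℝ {x ∈ vertexVectors G | cutForm e D x = 0}

theorem bridgesCoparallelTo_of_le_tightSpan [Finite V] (hG : G.IsEdgeConnected 2) {S : Set V}
    {D : Set (Sym2 V)} (hD : cut G S = D) {e : G.edgeSet} (he : (e : Sym2 V) ∈ D)
    (hle : Submodule.span ℝ (vertexVectors G) ⊓ LinearMap.ker (cutForm e D) ≤ tightSpan e D) :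
    BridgesCoparallelTo G S D := by
  have hDE : D ⊆ G.edgeSet := hD ▸ cut_subset_edgeSet G S
  intro u v hadj hbr
  set b : G.edgeSet := ⟨s((u : V), (v : V)), hadj⟩ with hb
  by_contra hcon
  have hdisj : ∀ g ∈ D, g ∉ coparClass G b := by
    intro g hg hgb
    obtain ⟨C, hC, hbC, hgC⟩ := (exists_isCoparallelClass_iff hG b.2).mpr hgb
    exact hcon ⟨C, hC, hbC, g, hg, hgC⟩
  have hind := hD ▸ induce_deleteEdges_cut G S
  obtain ⟨A, hA⟩ : ∃ A, cut G A \ D = {(b : Sym2 V)} := by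
    rw [← hind] at hadj hbr
    obtain ⟨A, -, hA⟩ := exists_cut_of_induce_isBridge
      (by rw [cut_deleteEdges, hD, Set.sdiff_self]) hadj hbr
    exact ⟨A, by rwa [cut_deleteEdges] at hA⟩
  wlog heA : (e : Sym2 V) ∉ cut G A generalizing A
  · refine this (S ∆ A) ?_ ?_
    · rw [← hA, cut_symmDiff, hD]
      ext x
      simp only [Set.mem_sdiff, Set.mem_symmDiff]
      tauto
    · rw [cut_symmDiff, hD, Set.mem_symmDiff]
      tauto
  have hbA : (b : Sym2 V) ∈ cut G A ∧ (b : Sym2 V) ∉ D := by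
    have : (b : Sym2 V) ∈ cut G A \ D := by simp [hA]
    exact this
  have hADE : cut G A ∩ D ⊆ G.edgeSet := Set.inter_subset_right.trans hDE
  have hker : tightSpan e D ≤ LinearMap.ker
      (LinearMap.proj b - edgeSum G (cut G A ∩ D) : (G.edgeSet → ℝ) →ₗ[ℝ] ℝ) := by
    rw [tightSpan, Submodule.span_le]
    rintro _ ⟨⟨H, hH, rfl⟩, htight⟩
    rw [SetLike.mem_coe, LinearMap.mem_ker, LinearMap.sub_apply, LinearMap.proj_apply,
      edgeSum_incidenceVector hADE, sub_eq_zero]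
    have hcut := cut_inter_edgeSet_ne_singleton hH A
    have hsplit : ∀ x ∈ cut G A, x = b ∨ x ∈ D := by
      intro x hx
      by_cases hxD : x ∈ D
      · exact Or.inr hxD
      · exact Or.inl (hA.le ⟨hx, hxD⟩)
    have hzero : cut G A ∩ D ∩ H.edgeSet = ∅ → (b : Sym2 V) ∉ H.edgeSet := by
      intro h0 hbH
      refine hcut b (Set.Subset.antisymm (fun x hx => ?_)
        (Set.singleton_subset_iff.mpr ⟨hbA.1, hbH⟩))
      rcases hsplit x hx.1 with h | h
      · exact h
      · exact absurd ⟨⟨hx.1, h⟩, hx.2⟩ (Set.eq_empty_iff_forall_notMem.mp h0 x)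
    by_cases h0 : cut G A ∩ D ∩ H.edgeSet = ∅
    · rw [h0, incidenceVector_of_notMem (hzero h0)]
      simp
    · rcases eq_empty_or_eq_pair_of_cutForm_eq_zero hDE he htight with h | ⟨f, hfe, h⟩
      · exact absurd (by rw [Set.inter_assoc, h, Set.inter_empty]) h0
      · have hone : cut G A ∩ D ∩ H.edgeSet = {f} := by
          rw [Set.inter_assoc, h] at h0 ⊢
          obtain ⟨x, hxA, hx⟩ := Set.nonempty_iff_ne_empty.mpr h0
          have hxf : x = f := by
            rcases hx with rfl | hx
            exacts [absurd hxA heA, hx]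
          subst hxf
          refine Set.Subset.antisymm ?_ (Set.singleton_subset_iff.mpr ⟨hxA, Or.inr rfl⟩)
          rintro y ⟨hyA, rfl | hy⟩
          exacts [absurd hyA heA, hy]
        have hbH : (b : Sym2 V) ∈ H.edgeSet := by
          by_contra hbH
          refine hcut f (Eq.trans ?_ hone)
          ext x
          refine ⟨fun hx => ⟨⟨hx.1, ?_⟩, hx.2⟩, fun hx => ⟨hx.1.1, hx.2⟩⟩
          rcases hsplit x hx.1 with rfl | h
          exacts [absurd hx.2 hbH, h]
        rw [hone, incidenceVector_of_mem hbH]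
        simp
  have hbcore : (b : Sym2 V) ∈ core G := by
    rw [core_eq_edgeSet hG]
    exact b.2
  have hempty : ∀ F ⊆ D, F ∩ coparClass G b = ∅ := fun F hF =>
    Set.eq_empty_of_forall_notMem fun g hg => hdisj g (hF hg.1) hg.2
  have hmem : incidenceVector G (coparClass G b) ∈
      Submodule.span ℝ (vertexVectors G) ⊓ LinearMap.ker (cutForm e D) := by
    refine ⟨incidenceVector_coparClass_mem_span hbcore, ?_⟩
    rw [SetLike.mem_coe, LinearMap.mem_ker, cutForm_incidenceVector hDE, hempty D subset_rfl,
      incidenceVector_of_notMem (hdisj e he)]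
    simp
  have := hker (hle hmem)
  rw [LinearMap.mem_ker, LinearMap.sub_apply, LinearMap.proj_apply,
    edgeSum_incidenceVector hADE, hempty _ Set.inter_subset_right,
    incidenceVector_of_mem (self_mem_coparClass G b)] at this
  simp at this

theorem le_tightSpan_of_bridgesCoparallelTo [Finite V] (hG : G.IsEdgeConnected 2) {S : Set V}
    (hconn : ∀ A ⊆ S, cut G A ⊆ cut G S → A = ∅ ∨ A = S)
    (hconn' : ∀ A ⊆ Sᶜ, cut G A ⊆ cut G S → A = ∅ ∨ A = Sᶜ)
    {e : G.edgeSet} (he : (e : Sym2 V) ∈ cut G S)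
    (hbr : BridgesCoparallelTo G S (cut G S)) (hbr' : BridgesCoparallelTo G Sᶜ (cut G S)) :
    Submodule.span ℝ (vertexVectors G) ⊓ LinearMap.ker (cutForm e (cut G S)) ≤
      tightSpan e (cut G S) := by
  classical
  set D := cut G S with hD
  have hDE : D ⊆ G.edgeSet := cut_subset_edgeSet G S
  have hM : ∀ f : Sym2 V, ∀ H : G.Subgraph, H.coe.IsEdgeConnected 2 →
      D ∩ H.edgeSet ⊆ {(e : Sym2 V), f} → incidenceVector G H.edgeSet ∈ tightSpan e D :=
    fun f H hH hf => Submodule.subset_span ⟨⟨H, hH, rfl⟩,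
      cutForm_eq_zero hDE he (cut_inter_edgeSet_ne_singleton hH S) hf⟩
  let y : G.edgeSet → G.edgeSet → ℝ := fun f =>
    incidenceVector G (core (G.deleteEdges (D \ {(e : Sym2 V), (f : Sym2 V)})))
  have hy : ∀ f, y f ∈ tightSpan e D := by
    intro f
    refine incidenceVector_core_mem (SimpleGraph.deleteEdges_le _) fun H hH hHK =>
      hM f H hH fun d hd => ?_
    have := hHK hd.2
    rw [SimpleGraph.edgeSet_deleteEdges] at this
    by_contra h
    exact this.2 ⟨hd.1, h⟩
  have hle : tightSpan e D ≤ Submodule.span ℝ (vertexVectors G) :=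
    Submodule.span_mono fun x hx => hx.1
  rintro x ⟨hxW, hxker⟩
  let F : Finset G.edgeSet := Finset.univ.filter fun f => (f : Sym2 V) ∈ D \ {(e : Sym2 V)}
  have hsumM : ∑ f ∈ F, x f • y f ∈ tightSpan e D :=
    Submodule.sum_mem _ fun f _ => Submodule.smul_mem _ _ (hy f)
  set x' := x - ∑ f ∈ F, x f • y f with hx'
  suffices h : x' ∈ tightSpan e D by
    have := Submodule.add_mem _ h hsumM
    rwa [hx', sub_add_cancel] at this
  have hx'W : x' ∈ Submodule.span ℝ (vertexVectors G) :=
    Submodule.sub_mem _ hxW (hle hsumM)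
  have hye : ∀ f ∈ F, y f e = 1 := by
    intro f hf
    have hf' := (Finset.mem_filter.mp hf).2
    exact incidenceVector_of_mem (mem_core_deleteEdges_cut_sdiff_pair hconn hconn' he hf'.1
      (fun h => hf'.2 h.symm))
  have hyf : ∀ f ∈ F, y f f = 1 := by
    intro f hf
    have hf' := (Finset.mem_filter.mp hf).2
    refine incidenceVector_of_mem ?_
    rw [Set.pair_comm]
    exact mem_core_deleteEdges_cut_sdiff_pair hconn hconn' hf'.1 he hf'.2
  have hyg : ∀ f g : G.edgeSet, (g : Sym2 V) ∈ D → g ≠ e → g ≠ f → y f g = 0 := by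
    intro f g hg hge hgf
    refine incidenceVector_of_notMem fun h => ?_
    have := h.1
    rw [SimpleGraph.edgeSet_deleteEdges] at this
    refine this.2 ⟨hg, ?_⟩
    rintro (h | h)
    exacts [hge (Subtype.ext h), hgf (Subtype.ext h)]
  have hzero : ∀ g : G.edgeSet, (g : Sym2 V) ∈ D → x' g = 0 := by
    intro g hg
    rw [hx', Pi.sub_apply, Finset.sum_apply, sub_eq_zero]
    by_cases hge : g = e
    · subst hge
      have hk : x g - edgeSum G (D \ {(g : Sym2 V)}) x = 0 := hxker
      rw [edgeSum_apply, sub_eq_zero] at hk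
      rw [hk]
      refine Finset.sum_congr rfl fun f hf => ?_
      rw [Pi.smul_apply, hye f hf, smul_eq_mul, mul_one]
    · have hgF : g ∈ F := Finset.mem_filter.mpr
        ⟨Finset.mem_univ _, hg, fun h => hge (Subtype.ext h)⟩
      rw [Finset.sum_eq_single_of_mem g hgF, Pi.smul_apply, hyf g hgF, smul_eq_mul, mul_one]
      intro f _ hfg
      rw [Pi.smul_apply, hyg f g hg hge hfg.symm, smul_zero]
  refine mem_of_constant_on_coparClass (fun c d hd => apply_eq_of_mem_span hx'W hd) fun c => ?_
  by_cases hcD : (c : Sym2 V) ∈ D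
  · exact Or.inl (hzero c hcD)
  obtain ⟨-, p, hp, q, hq, hpq⟩ := id he
  obtain ⟨c, hcG⟩ := c
  induction c with | h u v =>
  have hbridge : ∀ T : Set V, cut G T = D → BridgesCoparallelTo G T D → u ∈ T → v ∈ T →
      s(u, v) ∉ core (G.deleteEdges D) → x' ⟨s(u, v), hcG⟩ = 0 := by
    intro T hTD hT hu hv hcore
    have hcK : s(u, v) ∈ (G.deleteEdges D).edgeSet := by
      rw [SimpleGraph.edgeSet_deleteEdges]
      exact ⟨hcG, hcD⟩
    obtain ⟨A, hA⟩ : ∃ A, cut (G.deleteEdges D) A = {s(u, v)} := by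
      by_contra hcon
      exact hcore ⟨hcK, not_exists.mp hcon⟩
    have hB := induce_isBridge_of_cut (T := T) (u := ⟨u, hu⟩) (v := ⟨v, hv⟩) hA
    rw [← hTD, induce_deleteEdges_cut] at hB
    obtain ⟨C, hC, hcC, g, hg, hgC⟩ := hT ⟨u, hu⟩ ⟨v, hv⟩ hcG hB
    have hgc := (exists_isCoparallelClass_iff hG hcG).mp ⟨C, hC, hcC, hgC⟩
    rw [← apply_eq_of_mem_span hx'W (c := ⟨s(u, v), hcG⟩) (d := ⟨g, hDE hg⟩) hgc]
    exact hzero _ hg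
  have huv : u ∈ S ↔ v ∈ S := by
    rw [hD, mk_mem_cut] at hcD
    have : G.Adj u v := hcG
    tauto
  by_cases hcore : s(u, v) ∈ core (G.deleteEdges D)
  · right
    by_cases hu : u ∈ S
    · refine incidenceVector_coparClass_mem_of_mem_core hconn hconn' hp hq (hpq ▸ he)
        (fun f _ H hH hf => hM f H hH (hpq ▸ hf)) hu hcore
    · have hc' : cut G Sᶜ = D := cut_compl G S
      refine incidenceVector_coparClass_mem_of_mem_core (S := Sᶜ) (p := q) (q := p)
        (by rwa [hc']) (by rwa [hc', compl_compl]) hq (by simpa using hp)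
        (by rw [hc', Sym2.eq_swap, ← hpq]; exact he)
        (fun f _ H hH hf => hM f H hH (by rwa [hc', Sym2.eq_swap, ← hpq] at hf)) hu
        (by rwa [hc'])
  · left
    by_cases hu : u ∈ S
    · exact hbridge S rfl hbr hu (huv.mp hu) hcore
    · exact hbridge Sᶜ (cut_compl G S) hbr' hu (fun h => hu (huv.mpr h)) hcore

end Facet

end TwoEdgeConn

open TwoEdgeConn

theorem mainTheorem5 {V : Type*} [Fintype V] (G : SimpleGraph V) [Fintype G.edgeSet]
    (hG : G.IsEdgeConnected 2)
    (S : Set V) (hS : S.Nonempty) (hS' : S ≠ Set.univ)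
    (hmin : TwoEdgeConn.IsMinimalCut G (TwoEdgeConn.cut G S))
    (hcard : 3 ≤ (TwoEdgeConn.cut G S).ncard)
    (e : G.edgeSet) (he : (e : Sym2 V) ∈ TwoEdgeConn.cut G S) :
    TwoEdgeConn.DefinesFacet (TwoEdgeConn.TECSP G)
        (LinearMap.proj e - TwoEdgeConn.edgeSum G (TwoEdgeConn.cut G S \ {(e : Sym2 V)})) 0 ↔
      TwoEdgeConn.BridgesCoparallelTo G S (TwoEdgeConn.cut G S) ∧
        TwoEdgeConn.BridgesCoparallelTo G Sᶜ (TwoEdgeConn.cut G S) := by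
  have hDE := cut_subset_edgeSet G S
  have hpre := ((isEdgeConnected_two_iff G).mp hG).1
  have hw : incidenceVector G (core G) ∈ Submodule.span ℝ (vertexVectors G) :=
    incidenceVector_core_mem le_rfl fun H hH _ =>
      Submodule.subset_span (show _ ∈ vertexVectors G from ⟨H, hH, rfl⟩)
  have haw : cutForm e (cut G S) (incidenceVector G (core G)) ≠ 0 := by
    rw [cutForm_incidenceVector hDE, core_eq_edgeSet hG, incidenceVector_of_mem e.2,
      Set.inter_eq_left.mpr hDE, Set.ncard_sdiff_singleton_of_mem he]
    have h2 : (2 : ℝ) ≤ ((cut G S).ncard - 1 : ℕ) := by exact_mod_cast (by omega)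
    linarith
  have hfacet := definesFacet_convexHull_iff (zero_mem_vertexVectors G) (a := cutForm e (cut G S))
    (by
      rintro _ ⟨H, hH, rfl⟩
      exact cutForm_nonpos hDE he (cut_inter_edgeSet_ne_singleton hH S e)) hw haw
  refine hfacet.trans ⟨fun h => ⟨?_, ?_⟩, fun h => ?_⟩
  · exact bridgesCoparallelTo_of_le_tightSpan hG rfl he h
  · exact bridgesCoparallelTo_of_le_tightSpan hG (cut_compl G S) he h
  · refine le_tightSpan_of_bridgesCoparallelTo hG
      (fun A hA => eq_empty_or_eq_of_cut_subset hpre hS' hmin hA) (fun A hA hAS => ?_) he h.1 h.2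
    refine eq_empty_or_eq_of_cut_subset hpre (by simpa using hS.ne_empty)
      (by rwa [cut_compl]) hA (by rwa [cut_compl])
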